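/- **Theorem 3.** Let $D$ be a division ring with centre $C$, of finite dimension $d^2$ over $C$, and let $\sigma$ be a ring automorphism of $D$ of finite inner order $n\ge 1$: there is $u\in D^\times$ with $\sigma^n=\iota_u$, where $\iota_u(a)=uau^{-1}$, and $\sigma^i$ is not an inner automorphism for $1\le i<n$. Let $u$ be chosen so that moreover $\sigma(u)=u$. Put $F=C\cap\mathrm{Fix}(\sigma)$, and let $R=D[t;\sigma]$ be the skew polynomial ring, in which $ta=\sigma(a)t$ for $a\in D$; then $u^{-1}t^n$ lies in the centre $C(R)$ of $R$. Let $f\in R$ be monic of degree $m\ge 1$ such that the greatest common right divisor of $f$ and $t$ is $1$. Let $h=\hat h(u^{-1}t^n)$, with $\hat h\in F[x]$ monic, be the minimal central left multiple of $f$, i.e. $h\in C(R)\cap Rf$ and $h$ has minimal degree among the nonzero elements of $C(R)\cap Rf$. Let $\mathcal E(f)=\{g\in R: fg\in Rf\}/Rf$ be the eigenring of $f$, an $F$-algebra, and call $f$ a generalised A-polynomial if $\mathcal E(f)$ is a (finite-dimensional) central simple algebra over $F$. Suppose that $\hat h$ is irreducible in $F[x]$. Then the following are equivalent: 1. $f$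 is a generalised A-polynomial; 2. $\hat h(x)=x-a$ for some $a\in F$; 3. $f$ right divides $u^{-1}t^n-a$ in $R$ (that is, $u^{-1}t^n-a\in Rf$) for some $a\in F$. In particular, if $f$ is a generalised A-polynomial, then $m\le n$. -/

import Mathlib

/-!
Skew polynomial rings `R = D[t; σ]` over a division ring `D`. The ring is Mathlib's
`SkewPolynomial D`; its twist `σ` is `SkewPolynomial.φ`, so that `t * a = σ(a) * t`.
-/

noncomputable section

namespace SkewEigen

section Inner

variable {D : Type*} [DivisionRing D]

/-- `τ` is the inner automorphism `ι_u : a ↦ u a u⁻¹`. -/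
def IsInnerBy (τ : D → D) (u : Dˣ) : Prop :=
  ∀ a : D, τ a = (u : D) * a * ((u⁻¹ : Dˣ) : D)

/-- `σ` has finite inner order `n`, with `σⁿ = ι_u`: `n` is positive, `σⁿ` is conjugation by `u`,
and no `σⁱ` with `1 ≤ i < n` is inner. -/
structure HasInnerOrder (σ : D ≃+* D) (n : ℕ) (u : Dˣ) : Prop where
  pos : 0 < n
  pow_eq : IsInnerBy (⇑σ)^[n] u
  not_inner : ∀ i : ℕ, 1 ≤ i → i < n → ∀ v : Dˣ, ¬ IsInnerBy (⇑σ)^[i] v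

end Inner

variable (D : Type*) [DivisionRing D] [MulSemiringAction (Multiplicative ℕ) D]

/-- The field `F = C ∩ Fix(σ)`, as a subfield of the centre `C` of `D`. -/
def fixedCenter : Subfield (Subring.center D) where
  carrier := {c | SkewPolynomial.φ (c : D) = c}
  mul_mem' {a b} ha hb := by
    simp only [Set.mem_ofPred_eq] at ha hb ⊢
    rw [Subring.coe_mul, map_mul, ha, hb]
  one_mem' := by simp
  add_mem' {a b} ha hb := by
    simp only [Set.mem_ofPred_eq] at ha hb ⊢
    rw [Subring.coe_add, map_add, ha, hb]
  zero_mem' := by simp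
  neg_mem' {a} ha := by
    simp only [Set.mem_ofPred_eq] at ha ⊢
    rw [Subring.coe_neg, map_neg, ha]
  inv_mem' a ha := by
    simp only [Set.mem_ofPred_eq] at ha ⊢
    have h : ((a⁻¹ : Subring.center D) : D) = (a : D)⁻¹ := by
      exact map_inv₀ (Subring.center D).subtype a
    rw [h, map_inv₀, ha]

/-- The field `F = C ∩ Fix(σ)` as a type. -/
def BaseField : Type _ := fixedCenter D

instance baseFieldField : Field (BaseField D) := inferInstanceAs (Field (fixedCenter D))

/-- `D` is an `F`-algebra through the inclusion `F ⊆ C ⊆ D`. -/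
instance baseFieldAlgebra : Algebra (BaseField D) D :=
  inferInstanceAs (Algebra (fixedCenter D) D)

theorem algebraMap_baseField (c : fixedCenter D) :
    algebraMap (BaseField D) D c = ((c : Subring.center D) : D) := rfl

/-- Elements of `F` are fixed by `σ`; this makes `D[t; σ]` an `F`-algebra. -/
instance baseField_smulCommClass : SMulCommClass (Multiplicative ℕ) (BaseField D) D where
  smul_comm m c x := by
    have hm := Function.iterate_fixed c.2 (Multiplicative.toAdd m)
    rw [SkewPolynomial.φ_iterate_apply, ofAdd_toAdd] at hm
    rw [Algebra.smul_def, Algebra.smul_def, smul_mul']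
    exact congrArg (· * (m • x)) hm

variable {D}

/-- The degree of a skew polynomial (`0` for the zero polynomial). -/
def natDegree (p : SkewPolynomial D) : ℕ := p.support.sup id

/-- A skew polynomial is monic if its leading coefficient is `1`. -/
def IsMonic (p : SkewPolynomial D) : Prop := p.coeff (natDegree p) = 1

/-- `e` is the (monic) greatest common right divisor of `f` and `g`. Here `RightDvd a b` (also
written `a ∣ᵣ b`) means `b = q a` for some `q`. -/
structure IsGCRD (e f g : SkewPolynomial D) : Prop where
  monic : IsMonic e
  dvd_left : RightDvd e f
  dvd_right : RightDvd e g
  greatest : ∀ e' : SkewPolynomial D, RightDvd e' f → RightDvd e' g → RightDvd e' e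

/-- The left ideal `R f`. -/
abbrev leftIdeal (f : SkewPolynomial D) : Ideal (SkewPolynomial D) := Ideal.span {f}

/-- The idealiser `I(f) = {g ∈ R : f g ∈ R f}`, as an `F`-subalgebra of `R`. -/
def idealiser (f : SkewPolynomial D) : Subalgebra (BaseField D) (SkewPolynomial D) where
  carrier := {g | f * g ∈ leftIdeal f}
  mul_mem' {a b} ha hb := by
    simp only [Set.mem_ofPred_eq] at ha hb ⊢
    obtain ⟨q, hq⟩ := Ideal.mem_span_singleton'.1 ha
    rw [← mul_assoc, ← hq, mul_assoc]
    exact Ideal.mul_mem_left _ _ hb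
  add_mem' {a b} ha hb := by
    simp only [Set.mem_ofPred_eq] at ha hb ⊢
    rw [mul_add]
    exact Ideal.add_mem _ ha hb
  algebraMap_mem' r := by
    simp only [Set.mem_ofPred_eq]
    rw [← Algebra.commutes]
    exact Ideal.mul_mem_left _ _ (Ideal.mem_span_singleton_self f)

/-- `R f` as a left ideal of `I(f)`. -/
def idealiserIdeal (f : SkewPolynomial D) : Ideal (idealiser f) :=
  (leftIdeal f).comap (idealiser f).val

instance idealiserIdeal_isTwoSided (f : SkewPolynomial D) :
    (idealiserIdeal f).IsTwoSided where
  mul_mem_of_left {a} b ha := by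
    obtain ⟨q, hq⟩ := Ideal.mem_span_singleton'.1 (Ideal.mem_comap.1 ha)
    refine Ideal.mem_comap.2 ?_
    rw [map_mul, ← hq, mul_assoc]
    exact Ideal.mul_mem_left _ _ b.2

/-- The eigenring `E(f) = I(f) / R f`, an `F`-algebra. -/
def Eigenring (f : SkewPolynomial D) : Type _ := idealiser f ⧸ idealiserIdeal f

instance eigenringRing (f : SkewPolynomial D) : Ring (Eigenring f) :=
  inferInstanceAs (Ring (idealiser f ⧸ idealiserIdeal f))

instance eigenringAlgebra (f : SkewPolynomial D) : Algebra (BaseField D) (Eigenring f) :=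
  Ideal.Quotient.algebra (BaseField D)

/-- `f` is a generalised A-polynomial: `E(f)` is a (finite-dimensional) central simple algebra
over `F`. -/
structure IsGeneralisedAPolynomial (f : SkewPolynomial D) : Prop where
  central : Algebra.IsCentral (BaseField D) (Eigenring f)
  simple : IsSimpleRing (Eigenring f)
  finite : FiniteDimensional (BaseField D) (Eigenring f)

/-- The element `u⁻¹ tⁿ` of `R`. -/
def centralVar (u : Dˣ) (n : ℕ) : SkewPolynomial D :=
  SkewPolynomial.C ((u⁻¹ : Dˣ) : D) * SkewPolynomial.X ^ n

/-- `h = ĥ(u⁻¹ tⁿ)`, with `ĥ ∈ F[x]` monic, is the minimal central left multiple of `f`: it is a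
central left multiple of `f`, and has minimal degree among the nonzero central left multiples. -/
structure IsMinCentralLeftMultiple (u : Dˣ) (n : ℕ) (f : SkewPolynomial D)
    (hhat : Polynomial (BaseField D)) : Prop where
  monic : hhat.Monic
  central : Polynomial.aeval (centralVar u n) hhat ∈ Subring.center (SkewPolynomial D)
  dvd : RightDvd f (Polynomial.aeval (centralVar u n) hhat)
  minimal : ∀ h' ∈ Subring.center (SkewPolynomial D), h' ≠ 0 → RightDvd f h' →
    natDegree (Polynomial.aeval (centralVar u n) hhat) ≤ natDegree h'

end SkewEigen

end

/-! Write v for the central element u⁻¹tⁿ. If the centre of E(f) is F, the class of v in E(f) is a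
scalar a, so f right divides v - a. Then f right divides both ĥ(v) and v - a. Were ĥ and x - a
coprime, a Bézout identity evaluated at v would put 1 in Rf, so the irreducible monic ĥ is x - a.
Comparing degrees gives m ≤ n.

Conversely, let f right divide v - a. Since f is coprime to t and nonconstant, a ≠ 0. Then A = R/R(v
- a) is a finite-dimensional central simple F-algebra: no σ^i with 0 < i < n is inner, and t is
invertible in A because tⁿ = ua there (`isSimpleRing_cyclicQuotient`, `isCentral_cyclicQuotient`).
As A is semisimple, Af is the left annihilator of an idempotent e, and E(f) is identified with eAe
(`exists_eigenring_corner`). A nonzero corner of a simple ring is simple with centre Z(A)e, hence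
E(f) is central simple over F. -/

noncomputable section

namespace SkewEigen

open SkewPolynomial

/-! ### Corners of simple rings, and idempotents in semisimple rings -/

section CornerRing

/-- In a simple ring, every nonzero element generates the unit two-sided ideal. -/
theorem exists_sum_mul_mul_eq_one {A : Type*} [Ring A] [IsSimpleRing A] {x : A} (hx : x ≠ 0) :
    ∃ (ι : Type) (_ : Fintype ι) (a b : ι → A), ∑ i, a i * x * b i = 1 := by
  have h1 : (1 : A) ∈ TwoSidedIdeal.span {x} :=
    IsSimpleRing.one_mem_of_ne_zero_mem _ hx (TwoSidedIdeal.subset_span rfl)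
  rw [TwoSidedIdeal.mem_span_iff_mem_addSubgroup_closure] at h1
  generalize (1 : A) = y at h1 ⊢
  induction h1 using AddSubgroup.closure_induction with
  | mem y hy =>
    obtain ⟨_, ⟨a, -, _, rfl, rfl⟩, b, -, rfl⟩ := hy
    exact ⟨Unit, inferInstance, fun _ ↦ a, fun _ ↦ b, by simp⟩
  | zero => exact ⟨Empty, inferInstance, Empty.elim, Empty.elim, by simp⟩
  | add y z _ _ hy hz =>
    obtain ⟨ι, _, a, b, rfl⟩ := hy
    obtain ⟨κ, _, a', b', rfl⟩ := hz
    exact ⟨ι ⊕ κ, inferInstance, Sum.elim a a', Sum.elim b b', by simp⟩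
  | neg y _ hy =>
    obtain ⟨ι, _, a, b, rfl⟩ := hy
    exact ⟨ι, inferInstance, fun i ↦ -a i, b, by simp⟩

variable {A E : Type*} [Ring A] [Ring E] [IsSimpleRing A]

/-- The corner ring `eAe` of a simple ring `A` is simple. -/
theorem isSimpleRing_of_corner [Nontrivial E]
    (ψ : E →ₙ+* A) (hψ : Function.Injective ψ) (hrange : ∀ a : A, ∃ x, ψ x = ψ 1 * a * ψ 1) : IsSimpleRing E := by
  refine .of_eq_bot_or_eq_top fun J ↦ ?_
  rw [or_iff_not_imp_left, ← J.one_mem_iff]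
  intro hJ
  obtain ⟨x, hx, hx0 : x ≠ 0⟩ := SetLike.exists_of_lt (bot_lt_iff_ne_bot.mpr hJ)
  -- With e = ψ 1, compressing 1 = ∑ aᵢ ψ(x) bᵢ to e · e turns each aᵢ, bᵢ into an element of the
  -- corner, since ψ(x) = e ψ(x) e.
  obtain ⟨ι, _, a, b, hab⟩ :=
    exists_sum_mul_mul_eq_one ((map_ne_zero_iff ψ hψ).2 hx0)
  choose l hl using hrange
  have hsum : ∑ i, l (a i) * x * l (b i) = 1 := by
    apply hψ
    have hx1 : ψ 1 * ψ x = ψ x := by rw [← map_mul, one_mul]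
    have h1x : ψ x * ψ 1 = ψ x := by rw [← map_mul, mul_one]
    have h11 : ψ 1 * ψ 1 = ψ 1 := by rw [← map_mul, mul_one]
    calc ψ (∑ i, l (a i) * x * l (b i)) = ψ 1 * (∑ i, a i * ψ x * b i) * ψ 1 := by
          rw [map_sum, Finset.mul_sum, Finset.sum_mul]
          refine Finset.sum_congr rfl fun i _ ↦ ?_
          rw [map_mul, map_mul, hl, hl]
          calc _ = ψ 1 * a i * (ψ 1 * ψ x * ψ 1) * b i * ψ 1 := by noncomm_ring
            _ = _ := by rw [hx1, h1x]; noncomm_ring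
      _ = ψ 1 := by rw [hab, mul_one, h11]
  rw [← hsum]
  exact sum_mem fun i _ ↦ J.mul_mem_right _ _ (J.mul_mem_left _ _ hx)

/-- The centre of the corner ring `eAe` of a simple ring `A` is `Z(A)e`. -/
theorem exists_center_of_corner [Nontrivial E]
    (ψ : E →ₙ+* A) (hψ : Function.Injective ψ) (hrange : ∀ a : A, ∃ x, ψ x = ψ 1 * a * ψ 1)
    {z : E} (hz : ∀ y, z * y = y * z) :
    ∃ w : A, (∀ y, w * y = y * w) ∧ ψ z = w * ψ 1 := by
  obtain ⟨ι, _, a, b, hab⟩ :=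
    exists_sum_mul_mul_eq_one ((map_ne_zero_iff ψ hψ).2 (one_ne_zero (α := E)))
  have h1z : ψ 1 * ψ z = ψ z := by rw [← map_mul, one_mul]
  have hz1 : ψ z * ψ 1 = ψ z := by rw [← map_mul, mul_one]
  have hcomm (y : A) : ψ z * y * ψ 1 = ψ 1 * y * ψ z := by
    obtain ⟨x, hx⟩ := hrange y
    calc ψ z * y * ψ 1 = ψ z * (ψ 1 * y * ψ 1) := by rw [← mul_assoc, ← mul_assoc, hz1]
      _ = (ψ 1 * y * ψ 1) * ψ z := by rw [← hx, ← map_mul, hz, map_mul]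
      _ = ψ 1 * y * ψ z := by rw [mul_assoc, h1z]
  -- The lift of z is w = ∑ aᵢ ψ(z) bᵢ, where ∑ aᵢ ψ(1) bᵢ = 1. Moving z from the left factor to the
  -- right one gives w y = y w.
  have hmid (y : A) : (∑ i, a i * ψ z * b i) * y * (∑ j, a j * ψ 1 * b j) =
      (∑ i, a i * ψ 1 * b i) * y * (∑ j, a j * ψ z * b j) := by
    simp only [Finset.sum_mul, Finset.mul_sum]
    refine Finset.sum_congr rfl fun j _ ↦ Finset.sum_congr rfl fun i _ ↦ ?_
    calc _ = a i * (ψ z * (b i * y * a j) * ψ 1) * b j := by noncomm_ring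
      _ = a i * (ψ 1 * (b i * y * a j) * ψ z) * b j := by rw [hcomm]
      _ = _ := by noncomm_ring
  refine ⟨∑ i, a i * ψ z * b i, fun y ↦ ?_, ?_⟩
  · simpa [hab] using hmid y
  · have h : (∑ i, a i * ψ z * b i) * ψ 1 = (∑ i, a i * ψ 1 * b i) * ψ z := by
      simp only [Finset.sum_mul]
      refine Finset.sum_congr rfl fun i _ ↦ ?_
      calc _ = a i * (ψ z * b i * ψ 1) := by noncomm_ring
        _ = a i * (ψ 1 * b i * ψ z) := by rw [hcomm]
        _ = _ := by noncomm_ring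
    rw [h, hab, one_mul]

end CornerRing

/-- A left ideal of a semisimple ring is generated by an idempotent. -/
theorem exists_idempotent_of_isSemisimpleRing {A : Type*} [Ring A] [IsSemisimpleRing A]
    (I : Ideal A) : ∃ e : A, e * e = e ∧ ∀ x, x ∈ I ↔ x * e = 0 := by
  obtain ⟨K, hK⟩ := exists_isCompl I
  obtain ⟨e', he', e, he, h1⟩ := Submodule.mem_sup.1
    (hK.codisjoint.eq_top ▸ Submodule.mem_top : (1 : A) ∈ I ⊔ K)
  -- Split 1 = e' + e along I ⊕ K. For x in I, x e = x - x e' lies in both I and K.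
  have hmul {x : A} (hx : x ∈ I) : x * e = 0 := by
    have hxe : x * e = x - x * e' := by rw [eq_sub_iff_add_eq', ← mul_add, h1, mul_one]
    exact Submodule.disjoint_def.1 hK.disjoint _
      (hxe ▸ I.sub_mem hx (I.mul_mem_left _ he')) (K.smul_mem x he)
  refine ⟨e, ?_, fun x ↦ ⟨hmul, fun hx ↦ ?_⟩⟩
  · have := hmul he'
    rw [eq_sub_of_add_eq h1, sub_mul, one_mul, sub_eq_zero] at this
    exact this.symm
  · rw [← mul_one x, ← h1, mul_add, hx, add_zero]
    exact I.mul_mem_left _ he'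

/-! ### Degrees and coefficients of skew polynomials -/

section Degree

variable {D : Type*} [DivisionRing D]

theorem le_natDegree_of_coeff_ne_zero {p : SkewPolynomial D} {k : ℕ} (h : p.coeff k ≠ 0) :
    k ≤ natDegree p :=
  Finset.le_sup (f := id) (mem_support_iff.2 h)

theorem coeff_eq_zero_of_natDegree_lt {p : SkewPolynomial D} {k : ℕ} (h : natDegree p < k) :
    p.coeff k = 0 :=
  of_not_not fun hk ↦ (le_natDegree_of_coeff_ne_zero hk).not_gt h

theorem coeff_natDegree_ne_zero {p : SkewPolynomial D} (hp : p ≠ 0) :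
    p.coeff (natDegree p) ≠ 0 := by
  obtain ⟨i, hi, h⟩ := Finset.exists_mem_eq_sup p.support
    (Finset.nonempty_iff_ne_empty.2 (mt support_eq_empty.1 hp)) id
  rw [natDegree, h]
  exact mem_support_iff.1 hi

theorem natDegree_monomial {k : ℕ} {a : D} (ha : a ≠ 0) : natDegree (monomial k a) = k := by
  simp [natDegree, ha]

variable [MulSemiringAction (Multiplicative ℕ) D]

theorem coeff_mul_eq_sum (p q : SkewPolynomial D) (k : ℕ) :
    (p * q).coeff k = ∑ x ∈ Finset.HasAntidiagonal.antidiagonal k, p.coeff x.1 * φ^[x.1] (q.coeff x.2) := by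
  simp only [φ_iterate_apply]
  exact SkewMonoidAlgebra.coeff_mul_antidiagonal_of_finset p q (Multiplicative.ofAdd k)
    (Finset.HasAntidiagonal.antidiagonal (A := ℕ) k)
    (fun {x} ↦ Finset.HasAntidiagonal.mem_antidiagonal (A := ℕ))

theorem φ_iterate_eq_zero_iff (k : ℕ) (a : D) : φ^[k] a = 0 ↔ a = 0 := by
  rw [φ_iterate_apply]
  exact map_eq_zero (MulSemiringAction.toRingHom (Multiplicative ℕ) D (Multiplicative.ofAdd k))

theorem coeff_C_mul (a : D) (p : SkewPolynomial D) (k : ℕ) :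
    (C a * p).coeff k = a * p.coeff k := by
  rw [coeff_mul_eq_sum, Finset.sum_eq_single (0, k)]
  · simp
  · rintro ⟨i, j⟩ hij hne
    have hi : i ≠ 0 := by
      rintro rfl
      simp_all
    simp [coeff_C_ne_zero hi]
  · simp

theorem coeff_mul_C (a : D) (p : SkewPolynomial D) (k : ℕ) :
    (p * C a).coeff k = p.coeff k * φ^[k] a := by
  rw [coeff_mul_eq_sum, Finset.sum_eq_single (k, 0)]
  · simp
  · rintro ⟨i, j⟩ hij hne
    have hj : j ≠ 0 := by
      rintro rfl
      simp_all
    simp only [coeff_C_ne_zero hj, iterate_map_zero, mul_zero]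
  · simp

/-- The leading coefficient of a product is the twisted product of leading coefficients. -/
theorem coeff_mul_natDegree_add (p q : SkewPolynomial D) :
    (p * q).coeff (natDegree p + natDegree q) =
      p.coeff (natDegree p) * φ^[natDegree p] (q.coeff (natDegree q)) := by
  rw [coeff_mul_eq_sum, Finset.sum_eq_single (natDegree p, natDegree q)]
  · rintro ⟨i, j⟩ hij hne
    rw [Finset.HasAntidiagonal.mem_antidiagonal] at hij
    rcases lt_trichotomy i (natDegree p) with h | h | h
    · have hj : natDegree q < j := by simp only at hij; omega
      simp only [coeff_eq_zero_of_natDegree_lt hj, iterate_map_zero, mul_zero]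
    · exact absurd (by simp only [Prod.mk.injEq]; simp only at hij; omega) hne
    · simp only [coeff_eq_zero_of_natDegree_lt h, zero_mul]
  · simp

/-- `D` has no zero divisors and `φ` is injective. -/
theorem coeff_mul_natDegree_add_ne_zero {p q : SkewPolynomial D} (hp : p ≠ 0) (hq : q ≠ 0) :
    (p * q).coeff (natDegree p + natDegree q) ≠ 0 := by
  rw [coeff_mul_natDegree_add]
  exact mul_ne_zero (coeff_natDegree_ne_zero hp)
    (mt (φ_iterate_eq_zero_iff _ _).1 (coeff_natDegree_ne_zero hq))

theorem natDegree_add_le_natDegree_mul {p q : SkewPolynomial D} (hp : p ≠ 0) (hq : q ≠ 0) :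
    natDegree p + natDegree q ≤ natDegree (p * q) :=
  le_natDegree_of_coeff_ne_zero (coeff_mul_natDegree_add_ne_zero hp hq)

theorem natDegree_le_of_rightDvd {f g : SkewPolynomial D} (hg : g ≠ 0) (h : f ∣ᵣ g) :
    natDegree f ≤ natDegree g := by
  obtain ⟨q, rfl⟩ := h
  refine le_trans (Nat.le_add_left _ _)
    (natDegree_add_le_natDegree_mul (p := q) (q := f) ?_ ?_) <;>
  · rintro rfl
    simp at hg

theorem not_rightDvd_one {f : SkewPolynomial D} (hf : 1 ≤ natDegree f) : ¬ f ∣ᵣ 1 := by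
  intro h
  have h1 : natDegree (1 : SkewPolynomial D) = 0 := natDegree_monomial (one_ne_zero (α := D))
  have := natDegree_le_of_rightDvd one_ne_zero h
  omega

theorem X_rightDvd_of_coeff_zero {p : SkewPolynomial D} (hp : p.coeff 0 = 0) : X ∣ᵣ p := by
  -- The hypothesis on the constant term does not survive induction; right division by t with
  -- remainder does.
  suffices h : ∀ p : SkewPolynomial D, ∃ q, p = q * X + C (p.coeff 0) by
    obtain ⟨q, hq⟩ := h p
    exact ⟨q, by rw [hq, hp, C_0, add_zero]⟩
  intro p
  induction p using SkewPolynomial.induction with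
  | h0 => exact ⟨0, by simp⟩
  | ha k r q _ _ ih =>
    obtain ⟨s, hs⟩ := ih
    cases k with
    | zero => exact ⟨s, by nth_rewrite 1 [hs]; simp [add_comm, add_left_comm]⟩
    | succ k =>
      refine ⟨monomial k r + s, ?_⟩
      rw [add_mul, monomial_mul_X, SkewPolynomial.coeff_add, coeff_monomial_succ, zero_add,
        add_assoc, ← hs]

/-- A polynomial coprime to `t` that right divides a nonzero monomial is constant. -/
theorem natDegree_eq_zero_of_rightDvd_monomial {f : SkewPolynomial D} (hft : IsGCRD 1 f X)
    {k : ℕ} {a : D} (ha : a ≠ 0) (h : f ∣ᵣ monomial k a) : natDegree f = 0 := by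
  have hf0 : f.coeff 0 ≠ 0 := by
    intro h0
    refine not_rightDvd_one ?_ (hft.greatest X (X_rightDvd_of_coeff_zero h0) ⟨1, by simp⟩)
    exact le_natDegree_of_coeff_ne_zero (by simp)
  obtain ⟨q, hq⟩ := h
  have hq0 : q ≠ 0 := by
    rintro rfl
    simp [ha] at hq
  have hf : f ≠ 0 := by
    rintro rfl
    simp at hf0
  have hne : q.support.Nonempty := Finset.nonempty_iff_ne_empty.2 (mt support_eq_empty.1 hq0)
  -- As f has nonzero constant term, q f has nonzero coefficients both at the lowest degree of q and
  -- at deg q + deg f. A monomial has only one, so deg f = 0.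
  have hmin : (q * f).coeff (q.support.min' hne) ≠ 0 := by
    rw [coeff_mul_eq_sum, Finset.sum_eq_single (q.support.min' hne, 0)]
    · exact mul_ne_zero (mem_support_iff.1 (Finset.min'_mem _ hne))
        (mt (φ_iterate_eq_zero_iff _ _).1 hf0)
    · rintro ⟨i, j⟩ hij hne'
      rw [Finset.HasAntidiagonal.mem_antidiagonal] at hij
      have hi : i < q.support.min' hne := by
        refine lt_of_le_of_ne (by simp only at hij; omega) fun hi ↦ hne' ?_
        simp only [Prod.mk.injEq]
        simp only at hij
        omega
      have : q.coeff i = 0 := notMem_support_iff.1 fun hmem ↦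
        (Finset.min'_le _ _ hmem).not_gt hi
      simp only [this, zero_mul]
    · simp
  have htop := coeff_mul_natDegree_add_ne_zero hq0 hf
  rw [← hq, coeff_monomial] at hmin htop
  have h1 := ite_ne_right_iff.1 hmin
  have h2 := ite_ne_right_iff.1 htop
  have h3 : q.support.min' hne ≤ natDegree q :=
    le_natDegree_of_coeff_ne_zero (mem_support_iff.1 (Finset.min'_mem _ _))
  omega

end Degree

/-! ### The central element u⁻¹tⁿ and the inner order -/

section CentralVar

variable {D : Type*} [DivisionRing D] [MulSemiringAction (Multiplicative ℕ) D]
  {σ : D ≃+* D} {n : ℕ} {u : Dˣ}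

theorem algebraMap_eq_C (c : BaseField D) :
    algebraMap (BaseField D) (SkewPolynomial D) c = C (algebraMap (BaseField D) D c) := rfl

theorem centralVar_eq_monomial : centralVar u n = monomial n ((u⁻¹ : Dˣ) : D) :=
  C_mul_X_pow_eq_monomial (n := n)

theorem iterate_eq (hσ : ∀ a : D, σ a = φ a) (i : ℕ) (a : D) : σ^[i] a = φ^[i] a :=
  congrFun (congrArg (·^[i]) (funext hσ : ⇑σ = ⇑(φ (R := D)))) a

/-- The element `u⁻¹tⁿ` is central. -/
theorem centralVar_mul_comm (hσ : ∀ a : D, σ a = φ a) (hn : HasInnerOrder σ n u)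
    (hu : σ (u : D) = u) (p : SkewPolynomial D) : centralVar u n * p = p * centralVar u n := by
  have hn' (a : D) : φ^[n] a = u * a * ((u⁻¹ : Dˣ) : D) := by rw [← iterate_eq hσ, hn.pow_eq]
  have hu' (k : ℕ) : φ^[k] ((u⁻¹ : Dˣ) : D) = ((u⁻¹ : Dˣ) : D) := by
    refine Function.iterate_fixed ?_ k
    rw [Units.val_inv_eq_inv_val, map_inv₀, ← hσ, hu]
  rw [centralVar_eq_monomial]
  induction p using SkewPolynomial.induction with
  | h0 => simp
  | ha k r q _ _ ih =>
    -- On a monomial the claim is u⁻¹ σⁿ(r) = r σᵏ(u⁻¹): both sides equal r u⁻¹.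
    rw [mul_add, add_mul, ih, monomial_mul_monomial, monomial_mul_monomial, hn', hu', add_comm n k]
    congr 2
    rw [← mul_assoc, ← mul_assoc, Units.inv_mul, one_mul]

/-- Distinct powers of `σ` below the inner order are not intertwined by a nonzero element. -/
theorem HasInnerOrder.eq_of_intertwines (hσ : ∀ a : D, σ a = φ a) (hn : HasInnerOrder σ n u)
    {i j : ℕ} (hi : i < n) (hj : j < n) {c : D} (hc : c ≠ 0)
    (h : ∀ b, c * φ^[i] b = φ^[j] b * c) : i = j := by
  simp only [← iterate_eq hσ] at h
  rcases lt_trichotomy i j with hij | hij | hij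
  -- Substituting a = σ^i(b) makes σ^(j-i) conjugation by c; in the symmetric case σ^(i-j) is
  -- conjugation by c⁻¹.
  · refine (hn.not_inner (j - i) (by omega) (by omega) (Units.mk0 c hc) fun a ↦ ?_).elim
    obtain ⟨b, rfl⟩ := (σ.surjective.iterate i) a
    rw [← Function.iterate_add_apply, Nat.sub_add_cancel hij.le]
    simp [h, hc]
  · exact hij
  · refine (hn.not_inner (i - j) (by omega) (by omega) (Units.mk0 c hc)⁻¹ fun a ↦ ?_).elim
    obtain ⟨b, rfl⟩ := (σ.surjective.iterate j) a
    rw [← Function.iterate_add_apply, Nat.sub_add_cancel hij.le]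
    simp [mul_assoc, ← h, hc]

end CentralVar

/-! ### Finiteness of D over F -/

section Finite

variable {D : Type*} [DivisionRing D] [MulSemiringAction (Multiplicative ℕ) D]

/-- `D` is finite-dimensional over `F = C ∩ Fix(σ)`: a power of `σ` is trivial on `C`. -/
theorem finiteDimensional_baseField [FiniteDimensional (Subring.center D) D]
    {σ : D ≃+* D} (hσ : ∀ a : D, σ a = φ a) {n : ℕ} {u : Dˣ} (hn : HasInnerOrder σ n u) :
    FiniteDimensional (BaseField D) D := by
  let τ : RingAut (Subring.center D) := Subring.centerCongr σ
  have hτ (c : Subring.center D) : ((τ c : Subring.center D) : D) = σ c := rfl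
  have hpow (k : ℕ) (c : Subring.center D) : (((τ ^ k) c : Subring.center D) : D) = σ^[k] c := by
    induction k generalizing c with
    | zero => rfl
    | succ k ih => rw [pow_succ, RingAut.mul_apply, ih, hτ, Function.iterate_succ_apply]
  have hfin : IsOfFinOrder τ := isOfFinOrder_iff_pow_eq_one.2 ⟨n, hn.pos, by
    ext c
    rw [hpow, hn.pow_eq, Subring.mem_center_iff.1 c.2 u, mul_assoc, Units.mul_inv, mul_one]
    rfl⟩
  have : Finite (Subgroup.zpowers τ) := finite_zpowers.2 hfin
  have hle : FixedPoints.subfield (Subgroup.zpowers τ) (Subring.center D) = fixedCenter D := by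
    ext c
    have : c ∈ fixedCenter D ↔ τ c = c := by
      rw [Subtype.ext_iff, hτ, hσ]; rfl
    rw [this]
    constructor
    · intro h
      exact h ⟨τ, Subgroup.mem_zpowers τ⟩
    · rintro h ⟨_, k, rfl⟩
      have hs : τ ∈ MulAction.stabilizer (RingAut (Subring.center D)) c := h
      exact (Subgroup.zpow_mem _ hs k : _)
  -- Artin's theorem: C is finite over the fixed field of the finite group generated by σ restricted
  -- to C.
  have h1 : FiniteDimensional (FixedPoints.subfield (Subgroup.zpowers τ) (Subring.center D))
    (Subring.center D) := inferInstance
  rw [hle] at h1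
  exact Module.Finite.trans (R := fixedCenter D) (Subring.center D) D

end Finite

/-! ### The central simple algebra R/R(u⁻¹tⁿ - a) -/

section CyclicAlgebra

variable {D : Type*} [DivisionRing D] [MulSemiringAction (Multiplicative ℕ) D]

/-- The skew polynomial `u⁻¹tⁿ - a`. -/
def cyclicModulus (u : Dˣ) (n : ℕ) (a : BaseField D) : SkewPolynomial D :=
  centralVar u n - algebraMap (BaseField D) (SkewPolynomial D) a

/-- The quotient `R / R(u⁻¹tⁿ - a)`. -/
abbrev CyclicQuotient (u : Dˣ) (n : ℕ) (a : BaseField D) : Type _ :=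
  SkewPolynomial D ⧸ leftIdeal (cyclicModulus u n a)

/-- The quotient map onto `R / R(u⁻¹tⁿ - a)`. -/
abbrev cyclicMk (u : Dˣ) (n : ℕ) (a : BaseField D)
    [(leftIdeal (cyclicModulus u n a)).IsTwoSided] : SkewPolynomial D →+* CyclicQuotient u n a :=
  Ideal.Quotient.mk (leftIdeal (cyclicModulus u n a))

variable {σ : D ≃+* D} {n : ℕ} {u : Dˣ} {a : BaseField D}

theorem cyclicModulus_mul_comm (hσ : ∀ a : D, σ a = φ a) (hn : HasInnerOrder σ n u)
    (hu : σ (u : D) = u) (p : SkewPolynomial D) :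
    cyclicModulus u n a * p = p * cyclicModulus u n a := by
  rw [cyclicModulus, sub_mul, mul_sub, centralVar_mul_comm hσ hn hu, Algebra.commutes]

theorem isTwoSided_span_cyclicModulus (hσ : ∀ a : D, σ a = φ a) (hn : HasInnerOrder σ n u)
    (hu : σ (u : D) = u) : (leftIdeal (cyclicModulus u n a)).IsTwoSided where
  mul_mem_of_left {p} q hp := by
    obtain ⟨r, rfl⟩ := Ideal.mem_span_singleton'.1 hp
    rw [mul_assoc, cyclicModulus_mul_comm hσ hn hu, ← mul_assoc]
    exact Ideal.mul_mem_left _ _ (Ideal.mem_span_singleton_self _)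

theorem coeff_cyclicModulus (hn : 0 < n) : (cyclicModulus u n a).coeff n = ((u⁻¹ : Dˣ) : D) := by
  rw [cyclicModulus, SkewPolynomial.coeff_sub, centralVar_eq_monomial, coeff_monomial, if_pos rfl,
    algebraMap_eq_C, coeff_C_ne_zero hn.ne', sub_zero]

theorem cyclicModulus_ne_zero (hn : 0 < n) : cyclicModulus u n a ≠ 0 := by
  intro h
  have := coeff_cyclicModulus (u := u) (a := a) hn
  rw [h, SkewPolynomial.coeff_zero] at this
  exact u⁻¹.ne_zero this.symm

theorem natDegree_cyclicModulus (hn : 0 < n) : natDegree (cyclicModulus u n a) = n := by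
  refine le_antisymm (Finset.sup_le fun i hi ↦ ?_) (le_natDegree_of_coeff_ne_zero ?_)
  · by_contra h
    have hi' : n < i := not_le.1 h
    refine mem_support_iff.1 hi ?_
    rw [cyclicModulus, SkewPolynomial.coeff_sub, centralVar_eq_monomial, coeff_monomial,
      if_neg hi'.ne, algebraMap_eq_C, coeff_C_ne_zero (by omega), sub_zero]
  · rw [coeff_cyclicModulus hn]
    exact u⁻¹.ne_zero

/-- A multiple of `u⁻¹tⁿ - a` of degree below `n` vanishes. -/
theorem eq_zero_of_mem_span_cyclicModulus (hn : 0 < n) {p : SkewPolynomial D}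
    (hp : p ∈ leftIdeal (cyclicModulus u n a)) (hdeg : ∀ i, n ≤ i → p.coeff i = 0) : p = 0 := by
  obtain ⟨q, rfl⟩ := Ideal.mem_span_singleton'.1 hp
  by_contra h
  have hq : q ≠ 0 := by
    rintro rfl
    simp at h
  refine coeff_mul_natDegree_add_ne_zero hq (cyclicModulus_ne_zero (u := u) (a := a) hn)
    (hdeg _ ?_)
  rw [natDegree_cyclicModulus hn]
  exact Nat.le_add_left _ _

/-- The modulus multiplied by u: the rewriting rule tⁿ ≡ ua used to reduce degrees. -/
theorem X_pow_sub_mem_span_cyclicModulus :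
    (X ^ n - C (u * algebraMap (BaseField D) D a) : SkewPolynomial D) ∈
      leftIdeal (cyclicModulus u n a) := by
  refine Ideal.mem_span_singleton'.2 ⟨C (u : D), ?_⟩
  rw [cyclicModulus, mul_sub, centralVar, ← mul_assoc, ← C_mul, Units.mul_inv, C_1, one_mul,
    algebraMap_eq_C, ← C_mul]

/-- Division with remainder by `u⁻¹tⁿ - a`. -/
theorem exists_remainder (hn : 0 < n) (p : SkewPolynomial D) :
    ∃ r : SkewPolynomial D, (∀ i, n ≤ i → r.coeff i = 0) ∧
      p - r ∈ leftIdeal (cyclicModulus u n a) := by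
  induction p using SkewPolynomial.induction with
  | h0 => exact ⟨0, by simp, by simp⟩
  | ha k c q _ _ ih =>
    obtain ⟨s, hs, hqs⟩ := ih
    suffices h : ∀ c : D, ∃ r : SkewPolynomial D, (∀ i, n ≤ i → r.coeff i = 0) ∧
        monomial k c - r ∈ leftIdeal (cyclicModulus u n a) by
      obtain ⟨r, hr, hkr⟩ := h c
      refine ⟨r + s, fun i hi ↦ by rw [SkewPolynomial.coeff_add, hr i hi, hs i hi, add_zero], ?_⟩
      rw [add_sub_add_comm]
      exact add_mem hkr hqs
    clear * - hn
    induction k using Nat.strong_induction_on with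
    | _ k ih =>
      intro c
      rcases lt_or_ge k n with hk | hk
      · refine ⟨monomial k c, fun i hi ↦ ?_, by simp⟩
        rw [coeff_monomial, if_neg (by omega)]
      -- c tᵏ = c tᵏ⁻ⁿ tⁿ ≡ c tᵏ⁻ⁿ ua, and ua passes through tᵏ⁻ⁿ by `φ^[k - n]`.
      · obtain ⟨r, hr, hkr⟩ := ih (k - n) (by omega)
          (c * φ^[k - n] (u * algebraMap (BaseField D) D a))
        refine ⟨r, hr, ?_⟩
        have h := Ideal.mul_mem_left _ (monomial (k - n) c)
          (X_pow_sub_mem_span_cyclicModulus (n := n) (u := u) (a := a))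
        rw [mul_sub, monomial_mul_X_pow, Nat.sub_add_cancel hk, monomial_mul_C] at h
        simpa using add_mem h hkr

variable [(leftIdeal (cyclicModulus u n a)).IsTwoSided]

theorem exists_cyclicMk_eq (hn : 0 < n) (x : CyclicQuotient u n a) :
    ∃ r : SkewPolynomial D, (∀ i, n ≤ i → r.coeff i = 0) ∧ cyclicMk u n a r = x := by
  obtain ⟨p, rfl⟩ := Ideal.Quotient.mk_surjective x
  obtain ⟨r, hr, hpr⟩ := exists_remainder (u := u) (a := a) hn p
  exact ⟨r, hr, ((Ideal.Quotient.mk_eq_mk_iff_sub_mem _ _).2 hpr).symm⟩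

theorem eq_zero_of_cyclicMk_eq_zero (hn : 0 < n) {r : SkewPolynomial D}
    (hr : ∀ i, n ≤ i → r.coeff i = 0) (h : cyclicMk u n a r = 0) : r = 0 :=
  eq_zero_of_mem_span_cyclicModulus hn (Ideal.Quotient.eq_zero_iff_mem.1 h) hr

theorem cyclicMk_X_pow :
    cyclicMk u n a (X ^ n) = cyclicMk u n a (C (u * algebraMap (BaseField D) D a)) :=
  (Ideal.Quotient.mk_eq_mk_iff_sub_mem _ _).2 X_pow_sub_mem_span_cyclicModulus

theorem nontrivial_cyclicQuotient (hn : 0 < n) : Nontrivial (CyclicQuotient u n a) := by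
  refine ⟨⟨0, 1, fun h ↦ ?_⟩⟩
  have h1 : (1 : SkewPolynomial D) = 0 := eq_zero_of_cyclicMk_eq_zero (u := u) (a := a) hn
    (fun i hi ↦ by rw [coeff_one, if_neg (by omega)]) (by rw [map_one, h])
  exact one_ne_zero h1

/-- `R / R(u⁻¹tⁿ - a)` is simple when `a ≠ 0`. -/
theorem isSimpleRing_cyclicQuotient (hσ : ∀ a : D, σ a = φ a) (hn : HasInnerOrder σ n u)
    (ha : a ≠ 0) : IsSimpleRing (CyclicQuotient u n a) := by
  have := nontrivial_cyclicQuotient (u := u) (a := a) hn.pos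
  refine .of_eq_bot_or_eq_top fun J ↦ ?_
  rw [or_iff_not_imp_left, ← J.one_mem_iff]
  intro hJ
  -- Shortest-element argument: choose a nonzero reduced representative of an element of J with the
  -- fewest terms.
  let P : SkewPolynomial D → Prop := fun r ↦
    r ≠ 0 ∧ (∀ i, n ≤ i → r.coeff i = 0) ∧ cyclicMk u n a r ∈ J
  have hP : ∃ k, ∃ r, P r ∧ r.support.card = k := by
    obtain ⟨x, hx, hx0 : x ≠ 0⟩ := SetLike.exists_of_lt (bot_lt_iff_ne_bot.mpr hJ)
    obtain ⟨r, hr, rfl⟩ := exists_cyclicMk_eq hn.pos x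
    exact ⟨_, r, ⟨fun h ↦ hx0 (by rw [h, map_zero]), hr, hx⟩, rfl⟩
  classical
  obtain ⟨r, ⟨hr0, hrn, hrJ⟩, hcard⟩ := Nat.find_spec hP
  have hmin (s : SkewPolynomial D) (hs : P s) : r.support.card ≤ s.support.card :=
    hcard ▸ Nat.find_min' hP ⟨s, hs, rfl⟩
  obtain ⟨j, hj⟩ := Finset.nonempty_iff_ne_empty.2 (mt support_eq_empty.1 hr0)
  have hj0 := mem_support_iff.1 hj
  have hjn : j < n := not_le.1 fun h ↦ hj0 (hrn j h)
  obtain ⟨r', hr'⟩ : ∃ r', r' = C (r.coeff j)⁻¹ * r := ⟨_, rfl⟩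
  have hcoeff (i : ℕ) : r'.coeff i = (r.coeff j)⁻¹ * r.coeff i := by
    rw [hr', coeff_C_mul]
  have hr'J : cyclicMk u n a r' ∈ J := by
    rw [hr', map_mul]
    exact J.mul_mem_left _ _ hrJ
  -- Since r' has coefficient 1 at j, the difference r' b - σ^j(b) r' loses that term and creates no
  -- new one, so it vanishes by minimality.
  have hcomm (b : D) (i : ℕ) : r'.coeff i * φ^[i] b = φ^[j] b * r'.coeff i := by
    have hs (i : ℕ) : (r' * C b - C (φ^[j] b) * r').coeff i =
        r'.coeff i * φ^[i] b - φ^[j] b * r'.coeff i := by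
      rw [SkewPolynomial.coeff_sub, coeff_mul_C, coeff_C_mul]
    have hs0 : r' * C b - C (φ^[j] b) * r' = 0 := by
      by_contra hne
      refine (hmin _ ⟨hne, fun i hi ↦ ?_, ?_⟩).not_gt (Finset.card_lt_card ?_)
      · rw [hs, hcoeff, hrn i hi, mul_zero, zero_mul, mul_zero, sub_zero]
      · rw [map_sub, map_mul, map_mul]
        exact sub_mem (J.mul_mem_right _ _ hr'J) (J.mul_mem_left _ _ hr'J)
      · refine Finset.ssubset_iff_of_subset (fun i hi ↦ ?_) |>.2 ⟨j, hj, ?_⟩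
        · rw [mem_support_iff, hs, hcoeff] at hi
          rw [mem_support_iff]
          intro h
          simp [h] at hi
        · rw [notMem_support_iff, hs, hcoeff, inv_mul_cancel₀ hj0, one_mul, mul_one, sub_self]
    rw [← sub_eq_zero, ← hs, hs0, SkewPolynomial.coeff_zero]
  -- A nonzero coefficient at i ≠ j would intertwine σ^i and σ^j.
  have hr'X : r' = X ^ j := by
    ext i
    rw [X_pow_eq_monomial, coeff_monomial]
    split_ifs with hij
    · rw [← hij, hcoeff, inv_mul_cancel₀ hj0]
    · by_contra hi
      refine hij (hn.eq_of_intertwines hσ ?_ hjn hi (hcomm · i)).symm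
      refine not_le.1 fun h ↦ hi ?_
      rw [hcoeff, hrn i h, mul_zero]
  have hc : (u * algebraMap (BaseField D) D a : D) ≠ 0 :=
    mul_ne_zero u.ne_zero ((map_ne_zero _).2 ha)
  -- J contains tʲ, hence tⁿ = ua, which is a unit because a ≠ 0.
  have hXn : cyclicMk u n a (X ^ n) ∈ J := by
    have h : (X ^ n : SkewPolynomial D) = X ^ (n - j) * X ^ j := by
      rw [← pow_add, Nat.sub_add_cancel hjn.le]
    rw [h, map_mul, ← hr'X]
    exact J.mul_mem_left _ _ hr'J
  rw [cyclicMk_X_pow] at hXn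
  have h1 := J.mul_mem_left (cyclicMk u n a (C (u * algebraMap (BaseField D) D a)⁻¹)) _ hXn
  rwa [← map_mul, ← C_mul, inv_mul_cancel₀ hc, C_1, map_one] at h1

/-- The centre of `R / R(u⁻¹tⁿ - a)` is `F` when `a ≠ 0`. -/
theorem isCentral_cyclicQuotient (hσ : ∀ a : D, σ a = φ a) (hn : HasInnerOrder σ n u)
    (ha : a ≠ 0) : Algebra.IsCentral (BaseField D) (CyclicQuotient u n a) := by
  refine ⟨fun x hx ↦ ?_⟩
  rw [Subalgebra.mem_center_iff] at hx
  obtain ⟨r, hr, rfl⟩ := exists_cyclicMk_eq hn.pos x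
  have hcomm (b : D) (i : ℕ) : b * r.coeff i = r.coeff i * φ^[i] b := by
    have h0 : C b * r - r * C b = 0 := by
      refine eq_zero_of_cyclicMk_eq_zero (u := u) (a := a) hn.pos (fun i hi ↦ ?_) ?_
      · rw [SkewPolynomial.coeff_sub, coeff_mul_C, coeff_C_mul, hr i hi, mul_zero, zero_mul,
          sub_zero]
      · rw [map_sub, map_mul, map_mul, hx, sub_self]
    have := congrArg (fun p ↦ coeff p i) h0
    simpa [coeff_mul_C, coeff_C_mul, sub_eq_zero] using this
  -- Commuting with D makes each nonzero coefficient at i intertwine the identity and σ^i, which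
  -- forces i = 0.
  have hrC : r = C (r.coeff 0) := by
    ext i
    by_cases hi : i = 0
    · rw [hi, coeff_C_zero]
    · rw [coeff_C_ne_zero hi]
      by_contra h
      refine hi (hn.eq_of_intertwines hσ (not_le.1 fun h' ↦ h (hr i h')) hn.pos h fun b ↦ ?_)
      rw [← hcomm, Function.iterate_zero, id]
  generalize r.coeff 0 = c at hrC
  subst hrC
  have hc : c ∈ Subring.center D := by
    refine Subring.mem_center_iff.2 fun b ↦ ?_
    simpa using hcomm b 0
  have hua : (u * algebraMap (BaseField D) D a : D) ≠ 0 :=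
    mul_ne_zero u.ne_zero ((map_ne_zero _).2 ha)
  have hfix : φ c = c := by
    -- Commuting with t gives (σ(c) - c) t = 0. Multiplying by tⁿ⁻¹ yields a constant relation,
    -- which also covers n = 1, where t itself is not reduced.
    have h0 : cyclicMk u n a (C ((φ c - c) * (u * algebraMap (BaseField D) D a))) = 0 := by
      have hX : cyclicMk u n a (C (φ c - c) * X) = 0 := by
        have hXc : (X * C c : SkewPolynomial D) = C (φ c) * X := by
          rw [X, C_mul_monomial, monomial_mul_C, one_mul, mul_one, Function.iterate_one]
        rw [C_sub, sub_mul, map_sub, map_mul _ (C c), ← hx, ← map_mul, hXc, sub_self]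
      have h : (X ^ n : SkewPolynomial D) = X * X ^ (n - 1) := by
        rw [← pow_succ', Nat.sub_add_cancel hn.pos]
      rw [C_mul, map_mul, ← cyclicMk_X_pow, h, map_mul, ← mul_assoc, ← map_mul, hX, zero_mul]
    have h1 := eq_zero_of_cyclicMk_eq_zero hn.pos
      (fun i hi ↦ coeff_C_ne_zero (by have := hn.pos; omega)) h0
    rw [C_eq_zero, mul_eq_zero, or_iff_left hua, sub_eq_zero] at h1
    exact h1
  exact Algebra.mem_bot.2 ⟨(⟨⟨c, hc⟩, hfix⟩ : fixedCenter D), rfl⟩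

theorem finiteDimensional_cyclicQuotient [FiniteDimensional (BaseField D) D] (hn : 0 < n) :
    FiniteDimensional (BaseField D) (CyclicQuotient u n a) := by
  let T : (Fin n → D) →ₗ[BaseField D] CyclicQuotient u n a :=
    { toFun v := cyclicMk u n a (∑ i : Fin n, monomial (i : ℕ) (v i))
      map_add' v w := by
        simp [Finset.sum_add_distrib]
      map_smul' c v := by
        have : ∑ i : Fin n, monomial (i : ℕ) ((c • v) i) = c • ∑ i : Fin n, monomial (i : ℕ) (v i) := by
          rw [Finset.smul_sum]
          exact Finset.sum_congr rfl fun i _ ↦ (smul_monomial (i : ℕ) c (v i)).symm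
        rw [this]
        rfl }
  refine Module.Finite.of_surjective T fun x ↦ ?_
  obtain ⟨r, hr, rfl⟩ := exists_cyclicMk_eq hn x
  refine ⟨fun i ↦ r.coeff i, ?_⟩
  change cyclicMk u n a (∑ i : Fin n, monomial (i : ℕ) (r.coeff i)) = cyclicMk u n a r
  congr 1
  rw [Fin.sum_univ_eq_sum_range (fun i ↦ monomial i (r.coeff i)) n]
  conv_rhs => rw [← sum_monomial r]
  refine (sum_eq_of_subset _ (fun i ↦ monomial_zero_right i) fun i hi ↦ ?_).symm
  rw [Finset.mem_range]
  exact not_le.1 fun h ↦ mem_support_iff.1 hi (hr i h)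

end CyclicAlgebra

/-! ### The eigenring as a corner ring -/

section Eigenring

variable {D : Type*} [DivisionRing D] [MulSemiringAction (Multiplicative ℕ) D]

variable (f : SkewPolynomial D)

/-- The quotient map from the idealiser to the eigenring. -/
def eigenringMk : idealiser f →+* Eigenring f := Ideal.Quotient.mk (idealiserIdeal f)

variable {f}

theorem eigenringMk_surjective : Function.Surjective (eigenringMk f) := Ideal.Quotient.mk_surjective

theorem eigenringMk_eq_zero_iff (g : idealiser f) :
    eigenringMk f g = 0 ↔ (g : SkewPolynomial D) ∈ leftIdeal f :=
  Ideal.Quotient.eq_zero_iff_mem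

theorem algebraMap_eigenring (c : BaseField D) :
    algebraMap (BaseField D) (Eigenring f) c =
      eigenringMk f (algebraMap (BaseField D) (idealiser f) c) := rfl

theorem mem_leftIdeal_iff (g : SkewPolynomial D) : g ∈ leftIdeal f ↔ f ∣ᵣ g :=
  Ideal.mem_span_singleton'.trans (exists_congr fun _ ↦ eq_comm)

/-- If `π : R → A` is a surjection with kernel inside `Rf` and `Aπ(f)` is the left annihilator of
an idempotent `e`, then the eigenring of `f` embeds onto the corner ring `eAe`. -/
theorem exists_eigenring_corner {A : Type*} [Ring A] (π : SkewPolynomial D →+* A)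
    (hπ : Function.Surjective π) {e : A} (he : e * e = e)
    (hfe : ∀ p, p ∈ leftIdeal f ↔ π p * e = 0) :
    ∃ ψ : Eigenring f →ₙ+* A, Function.Injective ψ ∧ (∀ x, ∃ y, ψ y = ψ 1 * x * ψ 1) ∧
      ∀ g : idealiser f, ψ (eigenringMk f g) = π g * e := by
  have hf : π f * e = 0 := (hfe f).1 (Ideal.mem_span_singleton_self f)
  obtain ⟨q, hq⟩ : ∃ q, π (q * f) = 1 - e := by
    obtain ⟨p, hp⟩ := hπ (1 - e)
    have : p ∈ leftIdeal f := (hfe p).2 (by rw [hp, sub_mul, one_mul, he, sub_self])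
    obtain ⟨q, rfl⟩ := Ideal.mem_span_singleton'.1 this
    exact ⟨q, hp⟩
  -- Since 1 - e is a left multiple of π(f) and fg ∈ Rf, (1 - e) π(g) e = 0; so π(g) e lies in eAe,
  -- and g ↦ π(g) e is multiplicative.
  have hfix (g : idealiser f) : e * (π g * e) = π g * e := by
    have h : (1 - e) * (π g * e) = 0 := by
      rw [← hq, map_mul, mul_assoc, ← mul_assoc (π f), ← map_mul, (hfe _).1 g.2, mul_zero]
    rw [sub_mul, one_mul, sub_eq_zero] at h
    exact h.symm
  choose l hl using eigenringMk_surjective (f := f)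
  have hwell (g : idealiser f) : π (l (eigenringMk f g)) * e = π g * e := by
    rw [← sub_eq_zero, ← sub_mul, ← map_sub, ← hfe]
    refine (eigenringMk_eq_zero_iff (l (eigenringMk f g) - g)).1 ?_
    rw [map_sub, hl, sub_self]
  let ψ : Eigenring f →ₙ+* A :=
    { toFun y := π (l y) * e
      map_mul' x y := by
        have h := hwell (l x * l y)
        rw [map_mul, hl, hl] at h
        rw [h, MulMemClass.coe_mul, map_mul, mul_assoc, mul_assoc, hfix]
      map_zero' := by
        have h := hwell 0
        rwa [map_zero, ZeroMemClass.coe_zero, map_zero, zero_mul] at h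
      map_add' x y := by
        have h := hwell (l x + l y)
        rw [map_add, hl, hl] at h
        rw [h, AddMemClass.coe_add, map_add, add_mul] }
  have hψ1 : ψ 1 = e := by
    have h := hwell 1
    rwa [map_one, OneMemClass.coe_one, map_one, one_mul] at h
  refine ⟨ψ, (injective_iff_map_eq_zero ψ).2 fun y hy ↦ ?_, fun x ↦ ?_, hwell⟩
  · rw [← hl y, eigenringMk_eq_zero_iff]
    exact (hfe _).2 hy
  -- Any lift g of e x e idealises Rf, because π(f) e = 0.
  · obtain ⟨g, hg⟩ := hπ (e * x * e)
    have hgf : g ∈ idealiser f := by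
      refine (hfe _).2 ?_
      rw [map_mul, hg, ← mul_assoc, ← mul_assoc, hf, zero_mul, zero_mul, zero_mul]
    refine ⟨eigenringMk f ⟨g, hgf⟩, ?_⟩
    rw [hψ1]
    exact (hwell ⟨g, hgf⟩).trans (by rw [hg, mul_assoc, he])

variable {σ : D ≃+* D} {n : ℕ} {u : Dˣ} {a : BaseField D}

/-- If `f` is a nonunit right divisor of `u⁻¹tⁿ - a` with `a ≠ 0`, then its eigenring is a
finite-dimensional central simple `F`-algebra. -/
theorem isGeneralisedAPolynomial_of_rightDvd [FiniteDimensional (Subring.center D) D]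
    (hσ : ∀ a : D, σ a = φ a) (hn : HasInnerOrder σ n u) (hu : σ (u : D) = u)
    (hf1 : ¬ f ∣ᵣ 1) (ha : a ≠ 0) (hf : f ∣ᵣ cyclicModulus u n a) :
    IsGeneralisedAPolynomial f := by
  have := isTwoSided_span_cyclicModulus (a := a) hσ hn hu
  have := finiteDimensional_baseField hσ hn
  have := finiteDimensional_cyclicQuotient (u := u) (a := a) hn.pos
  have := isSimpleRing_cyclicQuotient hσ hn ha
  have hcentral := isCentral_cyclicQuotient hσ hn ha
  have : IsArtinianRing (CyclicQuotient u n a) := IsArtinianRing.of_finite (BaseField D) _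
  have : IsSemisimpleRing (CyclicQuotient u n a) :=
    IsSimpleRing.isSemisimpleRing_iff_isArtinianRing.2 this
  obtain ⟨e, he, hIe⟩ := exists_idempotent_of_isSemisimpleRing
    (Ideal.span {cyclicMk u n a f})
  -- The left ideal generated by the image of f pulls back to exactly Rf, because Rf contains the
  -- kernel R(u⁻¹tⁿ - a).
  have hfe (p : SkewPolynomial D) : p ∈ leftIdeal f ↔ cyclicMk u n a p * e = 0 := by
    rw [← hIe, Ideal.mem_span_singleton', Ideal.mem_span_singleton']
    constructor
    · rintro ⟨q, rfl⟩
      exact ⟨cyclicMk u n a q, (map_mul _ _ _).symm⟩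
    · rintro ⟨x, hx⟩
      obtain ⟨q, rfl⟩ := Ideal.Quotient.mk_surjective x
      rw [← map_mul, Ideal.Quotient.mk_eq_mk_iff_sub_mem] at hx
      have hle : leftIdeal (cyclicModulus u n a) ≤ leftIdeal f :=
        (Ideal.span_singleton_le_iff_mem _).2 ((mem_leftIdeal_iff _).2 hf)
      have h := sub_mem (Ideal.mul_mem_left (leftIdeal f) q (Ideal.mem_span_singleton_self f))
        (hle hx)
      rw [sub_sub_cancel] at h
      exact Ideal.mem_span_singleton'.1 h
  obtain ⟨ψ, hinj, hrange, hψ⟩ :=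
    exists_eigenring_corner (cyclicMk u n a) Ideal.Quotient.mk_surjective he hfe
  have hψ1 : ψ 1 = e := by
    simpa using hψ 1
  have : Nontrivial (Eigenring f) := by
    refine ⟨⟨0, 1, fun h ↦ hf1 ?_⟩⟩
    rw [← map_one (eigenringMk f), eq_comm, eigenringMk_eq_zero_iff] at h
    exact (mem_leftIdeal_iff _).1 h
  have hψF (c : BaseField D) : ψ (algebraMap (BaseField D) (Eigenring f) c) =
      algebraMap (BaseField D) (CyclicQuotient u n a) c * e := by
    rw [algebraMap_eigenring, hψ]
    rfl
  refine ⟨⟨fun z hz ↦ ?_⟩, isSimpleRing_of_corner ψ hinj hrange, ?_⟩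
  · rw [Subalgebra.mem_center_iff] at hz
    obtain ⟨w, hw, hzw⟩ := exists_center_of_corner ψ hinj hrange fun y ↦ (hz y).symm
    obtain ⟨c, rfl⟩ := Algebra.mem_bot.1
      (hcentral.out (Subalgebra.mem_center_iff.2 fun y ↦ (hw y).symm))
    refine Algebra.mem_bot.2 ⟨c, hinj ?_⟩
    rw [hψF, hzw, hψ1]
  · let ψF : Eigenring f →ₗ[BaseField D] CyclicQuotient u n a :=
      { toFun := ψ
        map_add' := map_add ψ
        map_smul' c y := by
          rw [Algebra.smul_def, map_mul, hψF, RingHom.id_apply, Algebra.smul_def, mul_assoc, ← hψ1,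
            ← map_mul, one_mul] }
    exact Module.Finite.of_injective ψF hinj

/-- Over a central eigenring, `u⁻¹tⁿ` acts as a scalar. -/
theorem exists_rightDvd_cyclicModulus (hσ : ∀ a : D, σ a = φ a) (hn : HasInnerOrder σ n u)
    (hu : σ (u : D) = u) (hf : Algebra.IsCentral (BaseField D) (Eigenring f)) :
    ∃ a : BaseField D, f ∣ᵣ cyclicModulus u n a := by
  have hmem : centralVar u n ∈ idealiser f := (mem_leftIdeal_iff _).2
    ⟨centralVar u n, (centralVar_mul_comm hσ hn hu f).symm⟩
  have hcenter : eigenringMk f ⟨centralVar u n, hmem⟩ ∈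
      Subalgebra.center (BaseField D) (Eigenring f) := by
    refine Subalgebra.mem_center_iff.2 fun y ↦ ?_
    obtain ⟨g, rfl⟩ := eigenringMk_surjective y
    rw [← map_mul, ← map_mul]
    exact congrArg _ (Subtype.ext (centralVar_mul_comm hσ hn hu g).symm)
  obtain ⟨a, ha⟩ := Algebra.mem_bot.1 (hf.out hcenter)
  refine ⟨a, (mem_leftIdeal_iff _).1 ((eigenringMk_eq_zero_iff
    (⟨centralVar u n, hmem⟩ - algebraMap (BaseField D) (idealiser f) a)).1 ?_)⟩
  rw [map_sub, ← ha, algebraMap_eigenring, sub_self]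

/-- An irreducible monic `ĥ` with `f` right dividing both `ĥ(u⁻¹tⁿ)` and `u⁻¹tⁿ - a` is
`x - a`. -/
theorem eq_X_sub_C_of_rightDvd {hhat : Polynomial (BaseField D)} (hmonic : hhat.Monic)
    (hirr : Irreducible hhat) (hf1 : ¬ f ∣ᵣ 1)
    (hf : f ∣ᵣ Polynomial.aeval (centralVar u n) hhat) (hfa : f ∣ᵣ cyclicModulus u n a) :
    hhat = Polynomial.X - Polynomial.C a := by
  have hX : Polynomial.aeval (centralVar u n) (Polynomial.X - Polynomial.C a) =
      cyclicModulus u n a := by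
    rw [map_sub, Polynomial.aeval_X, Polynomial.aeval_C, cyclicModulus]
  by_cases hdvd : hhat ∣ Polynomial.X - Polynomial.C a
  · exact Polynomial.eq_of_monic_of_associated hmonic (Polynomial.monic_X_sub_C a)
      (hirr.associated_of_dvd (Polynomial.irreducible_X_sub_C a) hdvd)
  -- Evaluating the Bézout identity at u⁻¹tⁿ would put 1 in Rf.
  · obtain ⟨p, q, hpq⟩ := (hirr.coprime_iff_not_dvd).2 hdvd
    refine absurd ?_ hf1
    have h := congrArg (Polynomial.aeval (centralVar u n)) hpq
    rw [map_add, map_mul, map_mul, map_one, hX] at h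
    rw [← h, ← mem_leftIdeal_iff]
    exact add_mem (Ideal.mul_mem_left _ _ ((mem_leftIdeal_iff _).2 hf))
      (Ideal.mul_mem_left _ _ ((mem_leftIdeal_iff _).2 hfa))

end Eigenring

end SkewEigen

end

/-! ### The equivalences and the degree bound -/

theorem theorem3 {D : Type*} [DivisionRing D] [MulSemiringAction (Multiplicative ℕ) D]
    (d : ℕ) [FiniteDimensional (Subring.center D) D]
    (hd : Module.finrank (Subring.center D) D = d ^ 2)
    (σ : D ≃+* D) (hσ : ∀ a : D, σ a = SkewPolynomial.φ a)
    (n : ℕ) (u : Dˣ) (hn : SkewEigen.HasInnerOrder σ n u) (hu : σ (u : D) = u)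
    (f : SkewPolynomial D) (hf : SkewEigen.IsMonic f) (hm : 1 ≤ SkewEigen.natDegree f)
    (hft : SkewEigen.IsGCRD 1 f SkewPolynomial.X)
    (hhat : Polynomial (SkewEigen.BaseField D))
    (hh : SkewEigen.IsMinCentralLeftMultiple u n f hhat)
    (hirr : Irreducible hhat) :
    (SkewEigen.IsGeneralisedAPolynomial f ↔
      ∃ a : SkewEigen.BaseField D, hhat = Polynomial.X - Polynomial.C a) ∧
    ((∃ a : SkewEigen.BaseField D, hhat = Polynomial.X - Polynomial.C a) ↔
      ∃ a : SkewEigen.BaseField D, f ∣ᵣ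
        (SkewPolynomial.C ((u⁻¹ : Dˣ) : D) * SkewPolynomial.X ^ n
          - SkewPolynomial.C (algebraMap (SkewEigen.BaseField D) D a))) ∧
    (SkewEigen.IsGeneralisedAPolynomial f → SkewEigen.natDegree f ≤ n) := by
  have hf1 := SkewEigen.not_rightDvd_one hm
  have hdvd_of_eq {a : SkewEigen.BaseField D} (ha : hhat = Polynomial.X - Polynomial.C a) :
      f ∣ᵣ SkewEigen.cyclicModulus u n a := by
    have h := hh.dvd
    rwa [ha, map_sub, Polynomial.aeval_X, Polynomial.aeval_C] at h
  have hA : SkewEigen.IsGeneralisedAPolynomial f →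
      ∃ a : SkewEigen.BaseField D, f ∣ᵣ SkewEigen.cyclicModulus u n a := fun h ↦
    SkewEigen.exists_rightDvd_cyclicModulus hσ hn hu h.central
  refine ⟨⟨fun h ↦ ?_, ?_⟩, ⟨?_, ?_⟩, fun h ↦ ?_⟩
  · obtain ⟨a, ha⟩ := hA h
    exact ⟨a, SkewEigen.eq_X_sub_C_of_rightDvd hh.monic hirr hf1 hh.dvd ha⟩
  · rintro ⟨a, ha⟩
    refine SkewEigen.isGeneralisedAPolynomial_of_rightDvd hσ hn hu hf1 ?_ (hdvd_of_eq ha)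
    -- If a = 0, then f right divides the monomial u⁻¹tⁿ; being coprime to t, it would be constant,
    -- against m ≥ 1.
    rintro rfl
    have h := hdvd_of_eq ha
    rw [SkewEigen.cyclicModulus, map_zero, sub_zero, SkewEigen.centralVar_eq_monomial] at h
    have := SkewEigen.natDegree_eq_zero_of_rightDvd_monomial hft u⁻¹.ne_zero h
    omega
  · rintro ⟨a, ha⟩
    exact ⟨a, hdvd_of_eq ha⟩
  · rintro ⟨a, ha⟩
    exact ⟨a, SkewEigen.eq_X_sub_C_of_rightDvd hh.monic hirr hf1 hh.dvd ha⟩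
  · obtain ⟨a, ha⟩ := hA h
    have := SkewEigen.natDegree_le_of_rightDvd (SkewEigen.cyclicModulus_ne_zero hn.pos) ha
    rwa [SkewEigen.natDegree_cyclicModulus hn.pos] at this
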